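/- **Proposition (pressure moving at speed 1 in intermediate depth).** Let $\omega(\xi)=\sqrt{\tanh(\xi)/\xi}$ for $\xi\neq 0$, $\omega(0)=1$, and use the Fourier convention $\widehat f(\xi)=\frac1{2\pi}\int_{\mathbb R} f(X)e^{-iX\xi}\,dX$, so that $f(X)=\int_{\mathbb R}\widehat f(\xi)e^{iX\xi}\,d\xi$. For a pressure $P(t,X)$ and a parameter $\mu>0$, the right-going amplitude $\zeta_R$ created by $P$ in the one-dimensional linear water waves equation with zero initial data is defined by $$\widehat{\zeta_R}(t,\xi)=-\frac i2\int_0^t \xi\,\omega(\sqrt\mu\,\xi)\,\widehat P(\tau,\xi)\,e^{i(\tau-t)\xi\omega(\sqrt\mu\,\xi)}\,d\tau,\qquad \zeta_R(t,X)=\int_{\mathbb R}\widehat{\zeta_R}(t,\xi)e^{iX\xi}\,d\xi .$$ There is an absolute constant $c>0$, and for every $\mu_{\max}>0$ there is a constant $C=C(\mu_{\max})>0$, such that the following holds for all $0<\mu\le\mu_{\max}$ and all (real- or complex-valued) $P_0\in L^1(\mathbb R)\cap H^1(\mathbb R)$ with $\widehat{P_0}(0)\neq0$. Let $\zeta_R$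 be the right-going amplitude created by $P(t,X)=P_0(X-t)$. For every $t\ge 0$, the function $\widehat{\zeta_R}(t,\cdot)$ is integrable and $$\widehat{\zeta_R}(t,\xi)=-\frac i2\,\xi\,\omega(\sqrt\mu\,\xi)\,\widehat{P_0}(\xi)\,e^{-it\xi}\int_{-t}^0 e^{is\xi(\omega(\sqrt\mu\,\xi)-1)}\,ds\qquad(\xi\in\mathbb R),$$ and $$|\zeta_R(t,\cdot)|_{L^\infty}\le C\Big(\frac{t^{1/3}}{\mu}|P_0|_{L^1}+\mu^{1/4}|P_0|_{H^1}\Big).$$ If moreover $X P_0\in H^1(\mathbb R)$, then $$\liminf_{t\to+\infty}\Big|\frac1{t^{1/3}}\zeta_R(t,\cdot)\Big|_{L^\infty}\ \ge\ \frac{c}{\mu^{2/3}}\,|\widehat{P_0}(0)|,$$ so the resonance grows like $t^{1/3}$: there are constants $0<a\le b$ (depending on $\mu$ and $P_0$) such that $a\,t^{1/3}\le|\zeta_R(t,\cdot)|_{L^\infty}\le b\,t^{1/3}$ for all sufficiently large $t$. -/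

import Mathlib

open MeasureTheory Filter Topology
open scoped ENNReal FourierTransform SchwartzMap

noncomputable section

namespace WaterWaves

/-- Fourier transform on `ℝ` in the variable dual to `e^{iXξ}`, normalised so that the inverse
transform is `g ↦ ∫ g(ξ) e^{iXξ} dξ`. -/
def hat (f : ℝ → ℂ) (ξ : ℝ) : ℂ :=
  ((2 * Real.pi : ℝ) : ℂ)⁻¹ * ∫ X : ℝ, Complex.exp (-(Complex.I * X * ξ)) * f X

/-- The inverse transform `X ↦ ∫ g(ξ) e^{iXξ} dξ`. -/
def invHat (g : ℝ → ℂ) (X : ℝ) : ℂ :=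
  ∫ ξ : ℝ, Complex.exp (Complex.I * X * ξ) * g ξ

/-- `ω(ξ) = √(tanh ξ / ξ)`, extended by continuity at `0`. -/
def omega (ξ : ℝ) : ℝ := if ξ = 0 then 1 else √(Real.tanh ξ / ξ)

/-- Fourier transform of the right-going part, created by the pressure `P(t, X)`, of the solution of
the linear water waves equation `∂ₜ²ζ + μ⁻¹ G_μ[0,0] ζ = -μ⁻¹ G_μ[0,0] P` with zero initial data;
here `μ⁻¹ G_μ[0,0]` is the Fourier multiplier `(ξ ω(√μ ξ))²`. -/
def zetaRHat (μ : ℝ) (P : ℝ → ℝ → ℂ) (t ξ : ℝ) : ℂ :=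
  -(Complex.I / 2) * ∫ τ in (0 : ℝ)..t,
    ((ξ * omega (√μ * ξ) : ℝ) : ℂ) * hat (P τ) ξ *
      Complex.exp (Complex.I * ((τ - t) * (ξ * omega (√μ * ξ)) : ℝ))

/-- The right-going amplitude `ζ_R(t, X)` created by the pressure `P`. -/
def zetaR (μ : ℝ) (P : ℝ → ℝ → ℂ) (t X : ℝ) : ℂ := invHat (zetaRHat μ P t) X

/-- The pressure `P(t, X) = P₀(X - t)`, moving at speed `1`. -/
def travelling (P₀ : ℝ → ℂ) (t X : ℝ) : ℂ := P₀ (X - t)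

/-- `f ∈ H¹(ℝ)`. -/
def MemH1 (f : ℝ → ℂ) : Prop :=
  ∃ hf : MemLp f 2 volume,
    TemperedDistribution.MemSobolev 1 2 ((hf.toLp f : Lp ℂ 2 (volume : Measure ℝ)) : 𝓢'(ℝ, ℂ))

open Classical in
/-- The `H¹(ℝ)` norm `(|f|²_{L²} + |f'|²_{L²})^{1/2} = |(1 + |D|²)^{1/2} f|_{L²}`, written on the
Fourier side; `𝓕` is the unitary Fourier transform of `L²(ℝ)` with kernel `e^{-2πiXξ}`, for which
`|D|` is multiplication by `2π|ξ|`. -/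
def eH1Norm (f : ℝ → ℂ) : ℝ≥0∞ :=
  if hf : MemLp f 2 (volume : Measure ℝ) then
    eLpNorm (fun ξ : ℝ => ((√(1 + (2 * Real.pi * ξ) ^ 2) : ℝ) : ℂ) *
      (𝓕 (hf.toLp f) : Lp ℂ 2 (volume : Measure ℝ)) ξ) 2 volume
  else ⊤

end WaterWaves

end

open WaterWaves

namespace WaterWaves

/-! In the frame moving with the pressure, the time integral becomes `t * phaseMean (t * ξ * (ω -
1))`, and `‖phaseMean a‖ ≤ min(1, 2/|a|)`. Everything rests on how far `ω(√μ ξ)` is from `1`.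

For `√μ|ξ| ≤ 1`, `1 - ω ≥ μξ²/24`, so the phase is at least cubic. With `r = (μt)^(1/3)`, `|ξ|`
times the phase mean is at most a constant times `r⁻¹/(1 + (rξ)²)`; integrating in `ξ` gives `t/r² =
t^(1/3)/μ^(2/3)` (`setLIntegral_low_le`). For `√μ|ξ| ≥ 1`, `1 - ω ≥ 1/24`, so the factor `t` is
absorbed and Cauchy–Schwarz against the `H¹` weight gives a bound uniform in `t`
(`setLIntegral_high_le`).

For the lower bound, look at the single point `X = t`, where `e^{iXξ}` cancels `e^{-itξ}`. Putting
`ξ = η/r` and using `ω(x) - 1 ~ -x²/6`, dominated convergence turns the low-frequency integral into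
`hat P₀ 0 * ∫ airyProfile`, while the high frequencies vanish after division by `t^(1/3)`. The limit
is nonzero because `airyProfile` has imaginary part `6(1 - cos(η³/6))/η² ≥ 0`. -/

/-! ### Elementary bounds on `ω` and its expansion at `0`. -/

theorem cube_div_three_le_mul_cosh_sub_sinh {x : ℝ} (hx : 0 ≤ x) :
    x ^ 3 / 3 ≤ x * Real.cosh x - Real.sinh x := by
  have hd : ∀ y : ℝ, HasDerivAt (fun y => y * Real.cosh y - Real.sinh y - y ^ 3 / 3)
      (y * Real.sinh y - y ^ 2) y := fun y => by
    have h := (((hasDerivAt_id' y).mul (Real.hasDerivAt_cosh y)).sub (Real.hasDerivAt_sinh y)).sub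
      (((hasDerivAt_id' y).pow 3).div_const 3)
    refine h.congr_deriv ?_
    simp only [Nat.cast_ofNat]
    ring
  have hm : MonotoneOn (fun y => y * Real.cosh y - Real.sinh y - y ^ 3 / 3) (Set.Ici 0) := by
    refine monotoneOn_of_hasDerivWithinAt_nonneg (convex_Ici 0)
      (fun y _ => (hd y).continuousAt.continuousWithinAt) (fun y _ => (hd y).hasDerivWithinAt) ?_
    intro y hy
    rw [interior_Ici] at hy
    have := Real.self_le_sinh_iff.mpr (le_of_lt hy)
    nlinarith [Set.mem_Ioi.mp hy]
  have := hm Set.self_mem_Ici hx hx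
  simp only [Real.sinh_zero] at this
  norm_num at this
  linarith

/-- The difference of the two sides vanishes at `0` and has nonnegative derivative, by the previous
bound. Together the two cubic bounds frame `1 - ω²` between `x²/(3 cosh x)` and `x²/3`. -/
theorem mul_cosh_sub_sinh_le {x : ℝ} (hx : 0 ≤ x) :
    x * Real.cosh x - Real.sinh x ≤ x ^ 3 * Real.cosh x / 3 := by
  have hd : ∀ y : ℝ, HasDerivAt (fun y => y ^ 3 * Real.cosh y / 3 - (y * Real.cosh y - Real.sinh y))
      (y * (y * Real.cosh y - Real.sinh y) + y ^ 3 * Real.sinh y / 3) y := fun y => by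
    have h := ((((hasDerivAt_id' y).pow 3).mul (Real.hasDerivAt_cosh y)).div_const 3).sub
      (((hasDerivAt_id' y).mul (Real.hasDerivAt_cosh y)).sub (Real.hasDerivAt_sinh y))
    refine h.congr_deriv ?_
    simp only [Nat.cast_ofNat, Pi.pow_apply]
    ring
  have hm : MonotoneOn (fun y => y ^ 3 * Real.cosh y / 3 - (y * Real.cosh y - Real.sinh y))
      (Set.Ici 0) := by
    refine monotoneOn_of_hasDerivWithinAt_nonneg (convex_Ici 0)
      (fun y _ => (hd y).continuousAt.continuousWithinAt) (fun y _ => (hd y).hasDerivWithinAt) ?_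
    intro y hy
    rw [interior_Ici] at hy
    have hy' : 0 < y := hy
    have h1 := cube_div_three_le_mul_cosh_sub_sinh hy'.le
    have h2 := Real.sinh_pos_iff.mpr hy'
    have h3 : 0 ≤ y * Real.cosh y - Real.sinh y := le_trans (by positivity) h1
    positivity
  have := hm Set.self_mem_Ici hx hx
  simp only [Real.sinh_zero] at this
  norm_num at this
  linarith

theorem omega_neg (x : ℝ) : omega (-x) = omega x := by
  simp [omega, Real.tanh_neg]

theorem omega_abs (x : ℝ) : omega |x| = omega x := by
  rcases abs_choice x with h | h <;> rw [h]
  exact omega_neg x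

theorem omega_nonneg (x : ℝ) : 0 ≤ omega x := by
  unfold omega
  split_ifs <;> positivity

theorem omega_sq_of_pos {x : ℝ} (hx : 0 < x) : omega x ^ 2 = Real.tanh x / x := by
  rw [omega, if_neg hx.ne', Real.sq_sqrt]
  have := Real.sinh_pos_iff.mpr hx
  have := Real.cosh_pos x
  rw [Real.tanh_eq_sinh_div_cosh]
  positivity

theorem one_sub_omega_sq_of_pos {x : ℝ} (hx : 0 < x) :
    1 - omega x ^ 2 = (x * Real.cosh x - Real.sinh x) / (x * Real.cosh x) := by
  have := (Real.cosh_pos x).ne'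
  rw [omega_sq_of_pos hx, Real.tanh_eq_sinh_div_cosh]
  field_simp

theorem omega_sq_mul_abs_le (x : ℝ) : omega x ^ 2 * |x| ≤ 1 := by
  rcases eq_or_ne x 0 with rfl | hx
  · simp
  have h := abs_pos.mpr hx
  rw [← omega_abs, omega_sq_of_pos h, div_mul_cancel₀ _ h.ne']
  exact (Real.tanh_lt_one _).le

theorem omega_sq_le_one (x : ℝ) : omega x ^ 2 ≤ 1 := by
  rcases eq_or_ne x 0 with rfl | hx
  · simp [omega]
  have h := abs_pos.mpr hx
  have h1 := one_sub_omega_sq_of_pos h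
  have h2 := cube_div_three_le_mul_cosh_sub_sinh h.le
  have h3 : 0 ≤ |x| * Real.cosh |x| - Real.sinh |x| := le_trans (by positivity) h2
  have : 0 ≤ 1 - omega |x| ^ 2 := by
    rw [h1]; have := Real.cosh_pos |x|; positivity
  rw [omega_abs] at this
  linarith

theorem omega_le_one (x : ℝ) : omega x ≤ 1 := by
  nlinarith [omega_sq_le_one x, omega_nonneg x]

theorem one_sub_omega_sq_le (x : ℝ) : 1 - omega x ^ 2 ≤ x ^ 2 / 3 := by
  rcases eq_or_ne x 0 with rfl | hx
  · simp [omega]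
  have h := abs_pos.mpr hx
  have hc := Real.cosh_pos |x|
  rw [← omega_abs, one_sub_omega_sq_of_pos h, div_le_iff₀ (by positivity), ← sq_abs]
  refine (mul_cosh_sub_sinh_le h.le).trans (le_of_eq ?_)
  ring

theorem le_one_sub_omega_sq (x : ℝ) : x ^ 2 / (3 * Real.cosh x) ≤ 1 - omega x ^ 2 := by
  rcases eq_or_ne x 0 with rfl | hx
  · simp [omega]
  have h := abs_pos.mpr hx
  have hc := Real.cosh_pos |x|
  rw [← omega_abs, ← sq_abs, ← Real.cosh_abs, one_sub_omega_sq_of_pos h,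
    div_le_div_iff₀ (by positivity) (by positivity)]
  have := cube_div_three_le_mul_cosh_sub_sinh h.le
  nlinarith

theorem half_one_sub_omega_sq_le (x : ℝ) : (1 - omega x ^ 2) / 2 ≤ 1 - omega x := by
  nlinarith [sq_nonneg (1 - omega x)]

theorem sq_div_le_one_sub_omega_of_abs_le_two {x : ℝ} (hx : |x| ≤ 2) :
    x ^ 2 / 24 ≤ 1 - omega x := by
  have h1 := half_one_sub_omega_sq_le x
  have h2 := le_one_sub_omega_sq x
  -- Since `cosh 2 ≤ 4`, the constant is `24 = 2 · 3 · 4`: the halving in `1 - ω ≥ (1 - ω²)/2`, the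
  -- `3` of the cubic bound, and this `4`.
  have h3 : Real.cosh x ≤ 4 := by
    refine (Real.cosh_le_cosh.mpr (hx.trans (le_abs_self 2))).trans ?_
    rw [Real.cosh_eq]
    have e1 : Real.exp 2 ≤ 7.4 := by
      have := Real.exp_one_lt_d9
      rw [show (2 : ℝ) = 1 + 1 by norm_num, Real.exp_add]
      nlinarith [Real.exp_pos 1]
    have e2 : Real.exp (-2) ≤ 0.6 := by
      refine (Real.exp_le_exp.mpr (show (-2 : ℝ) ≤ -1 by norm_num)).trans ?_
      have := Real.exp_neg_one_lt_d9
      linarith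
    linarith
  have h4 : x ^ 2 / 12 ≤ x ^ 2 / (3 * Real.cosh x) := by
    have := Real.cosh_pos x
    gcongr
    linarith
  linarith

theorem sq_div_le_one_sub_omega {x : ℝ} (hx : |x| ≤ 1) : x ^ 2 / 24 ≤ 1 - omega x :=
  sq_div_le_one_sub_omega_of_abs_le_two (hx.trans one_le_two)

theorem le_one_sub_omega {x : ℝ} (hx : 1 ≤ |x|) : 1 / 24 ≤ 1 - omega x := by
  rcases le_total |x| 2 with h | h
  · refine le_trans ?_ (sq_div_le_one_sub_omega_of_abs_le_two h)
    rw [← sq_abs]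
    nlinarith
  -- Beyond `2`, `ω² ≤ 1/|x| ≤ 1/2`, which already gives `1 - ω ≥ 1/4`.
  · nlinarith [half_one_sub_omega_sq_le x, omega_sq_mul_abs_le x, sq_nonneg (omega x)]

theorem measurable_omega : Measurable omega := by
  have h : Measurable Real.tanh := by
    simp_rw [funext Real.tanh_eq_sinh_div_cosh]
    exact Real.continuous_sinh.measurable.div Real.continuous_cosh.measurable
  exact Measurable.ite (measurableSet_singleton 0) measurable_const (h.div measurable_id).sqrt

theorem continuousAt_omega_zero : ContinuousAt omega 0 := by
  have h0 : omega 0 = 1 := by simp [omega]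
  have h : Tendsto (fun x : ℝ => 1 - x ^ 2 / 3) (𝓝 0) (𝓝 1) := by
    have : Continuous fun x : ℝ => 1 - x ^ 2 / 3 := by fun_prop
    simpa using this.tendsto 0
  rw [ContinuousAt, h0]
  refine tendsto_of_tendsto_of_tendsto_of_le_of_le h tendsto_const_nhds (fun x => ?_) omega_le_one
  simp only
  nlinarith [one_sub_omega_sq_le x, omega_nonneg x, omega_le_one x]

/-- Factor `ω - 1 = -(1 - ω²)/(1 + ω)`: the first factor is squeezed to `x²/3` and the second tends
to `1/2`. -/
theorem tendsto_omega_sub_one_div_sq :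
    Tendsto (fun x => (omega x - 1) / x ^ 2) (𝓝[≠] 0) (𝓝 (-1 / 6)) := by
  have h0 : omega 0 = 1 := by simp [omega]
  have h1 : Tendsto (fun x => (1 - omega x ^ 2) / x ^ 2) (𝓝[≠] 0) (𝓝 (1 / 3)) := by
    have h : Tendsto (fun x : ℝ => 1 / (3 * Real.cosh x)) (𝓝[≠] 0) (𝓝 (1 / 3)) := by
      have : ContinuousAt (fun x : ℝ => 1 / (3 * Real.cosh x)) 0 := by
        refine ContinuousAt.div continuousAt_const ?_ (by simp)
        exact (continuous_const.mul Real.continuous_cosh).continuousAt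
      simpa using this.tendsto.mono_left nhdsWithin_le_nhds
    refine tendsto_of_tendsto_of_tendsto_of_le_of_le' h tendsto_const_nhds ?_ ?_
    · filter_upwards [self_mem_nhdsWithin] with x hx
      have hx' : x ≠ 0 := hx
      rw [le_div_iff₀ (by positivity), div_mul_eq_mul_div, one_mul]
      exact le_one_sub_omega_sq x
    · filter_upwards [self_mem_nhdsWithin] with x hx
      have hx' : x ≠ 0 := hx
      rw [div_le_iff₀ (by positivity)]
      linarith [one_sub_omega_sq_le x]
  have h2 : Tendsto (fun x => -(1 + omega x)⁻¹) (𝓝[≠] 0) (𝓝 (-(1 + 1)⁻¹)) := by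
    have : Tendsto omega (𝓝[≠] 0) (𝓝 1) := by
      simpa [h0] using continuousAt_omega_zero.tendsto.mono_left nhdsWithin_le_nhds
    exact ((this.const_add 1).inv₀ (by norm_num)).neg
  rw [show (-1 / 6 : ℝ) = 1 / 3 * -(1 + 1)⁻¹ by norm_num]
  refine (h1.mul h2).congr fun x => ?_
  have : 1 + omega x ≠ 0 := by linarith [omega_nonneg x]
  field_simp
  ring

/-! ### The transform `hat` and the amplitude of a travelling pressure. -/

theorem hat_eq_fourier (f : ℝ → ℂ) (ξ : ℝ) :
    hat f ξ = ((2 * Real.pi : ℝ) : ℂ)⁻¹ * 𝓕 f (ξ / (2 * Real.pi)) := by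
  rw [hat, Real.fourier_real_eq_integral_exp_smul]
  congr 2 with X
  rw [smul_eq_mul]
  congr 2
  have : (Real.pi : ℂ) ≠ 0 := Complex.ofReal_ne_zero.mpr Real.pi_ne_zero
  push_cast
  field_simp

theorem continuous_fourier_of_integrable {f : ℝ → ℂ} (hf : Integrable f) : Continuous (𝓕 f) :=
  VectorFourier.fourierIntegral_continuous Real.continuous_fourierChar
    (by fun_prop) hf

theorem continuous_hat {f : ℝ → ℂ} (hf : Integrable f) : Continuous (hat f) := by
  rw [funext (hat_eq_fourier f)]
  have := continuous_fourier_of_integrable hf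
  fun_prop

theorem norm_hat_le (f : ℝ → ℂ) (ξ : ℝ) : ‖hat f ξ‖ ≤ (2 * Real.pi)⁻¹ * ∫ X, ‖f X‖ := by
  rw [hat_eq_fourier, norm_mul, norm_inv, Complex.norm_real,
    Real.norm_of_nonneg (by positivity)]
  gcongr
  exact VectorFourier.norm_fourierIntegral_le_integral_norm _ _ _ _ _

theorem hat_travelling (f : ℝ → ℂ) (τ ξ : ℝ) :
    hat (travelling f τ) ξ = Complex.exp (-(Complex.I * τ * ξ)) * hat f ξ := by
  have h := integral_sub_right_eq_self (μ := volume)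
    (fun X : ℝ => Complex.exp (-(Complex.I * τ * ξ)) * (Complex.exp (-(Complex.I * X * ξ)) * f X)) τ
  rw [hat, hat, mul_left_comm (Complex.exp _),
    ← integral_const_mul (Complex.exp (-(Complex.I * τ * ξ))), ← h]
  congr 2 with X
  rw [travelling, ← mul_assoc, ← Complex.exp_add]
  congr 2
  push_cast
  ring

/-- Translation multiplies the transform by `e^{-iτξ}`; substituting `s = τ - t` then pulls
`e^{-itξ}` out of the integral. -/
theorem zetaRHat_travelling (μ : ℝ) (f : ℝ → ℂ) (t ξ : ℝ) :
    zetaRHat μ (travelling f) t ξ =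
      -(Complex.I / 2) * ((ξ * omega (√μ * ξ) : ℝ) : ℂ) * hat f ξ *
        Complex.exp (-(Complex.I * t * ξ)) *
        ∫ s in (-t)..(0 : ℝ), Complex.exp (Complex.I * (s * ξ * (omega (√μ * ξ) - 1) : ℝ)) := by
  have h := intervalIntegral.integral_comp_sub_right (a := 0) (b := t)
    (fun s : ℝ => Complex.exp (Complex.I * (s * ξ * (omega (√μ * ξ) - 1) : ℝ))) t
  rw [zero_sub, sub_self] at h
  have e : ∀ τ : ℝ, ((ξ * omega (√μ * ξ) : ℝ) : ℂ) * hat (travelling f τ) ξ *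
      Complex.exp (Complex.I * ((τ - t) * (ξ * omega (√μ * ξ)) : ℝ)) =
      ((ξ * omega (√μ * ξ) : ℝ) : ℂ) * hat f ξ * Complex.exp (-(Complex.I * t * ξ)) *
        Complex.exp (Complex.I * ((τ - t) * ξ * (omega (√μ * ξ) - 1) : ℝ)) := fun τ => by
    have e' : Complex.exp (-(Complex.I * τ * ξ)) *
        Complex.exp (Complex.I * ((τ - t) * (ξ * omega (√μ * ξ)) : ℝ)) =
        Complex.exp (-(Complex.I * t * ξ)) *
        Complex.exp (Complex.I * ((τ - t) * ξ * (omega (√μ * ξ) - 1) : ℝ)) := by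
      rw [← Complex.exp_add, ← Complex.exp_add]
      congr 1
      push_cast
      ring
    rw [hat_travelling]
    linear_combination ((ξ * omega (√μ * ξ) : ℝ) : ℂ) * hat f ξ * e'
  rw [← h, zetaRHat]
  simp_rw [e, intervalIntegral.integral_const_mul]
  ring

/-! ### Size and imaginary part of the phase mean. -/

/-- The oscillatory mean `∫_{-1}^0 e^{isa} ds`. -/
noncomputable def phaseMean (a : ℝ) : ℂ :=
  ∫ s in (-1 : ℝ)..0, Complex.exp (Complex.I * ((s * a : ℝ) : ℂ))

theorem integral_exp_phase (t a : ℝ) :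
    ∫ s in (-t)..(0 : ℝ), Complex.exp (Complex.I * ((s * a : ℝ) : ℂ)) = t * phaseMean (t * a) := by
  have h := intervalIntegral.smul_integral_comp_mul_left (a := -1) (b := 0)
    (fun s : ℝ => Complex.exp (Complex.I * ((s * a : ℝ) : ℂ))) t
  rw [mul_neg_one, mul_zero] at h
  rw [← h, phaseMean, Complex.real_smul]
  congr 2 with s
  rw [mul_right_comm, mul_comm]
  ring_nf

theorem phaseMean_eq {a : ℝ} (ha : a ≠ 0) :
    phaseMean a = (1 - Complex.exp (-(Complex.I * a))) / (Complex.I * a) := by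
  have hc : Complex.I * (a : ℂ) ≠ 0 :=
    mul_ne_zero Complex.I_ne_zero (Complex.ofReal_ne_zero.mpr ha)
  have h := integral_exp_mul_complex (a := -1) (b := 0) hc
  rw [phaseMean]
  refine Eq.trans ?_ (h.trans ?_)
  · congr 1 with s
    push_cast
    ring_nf
  · simp

theorem norm_phaseMean_le_one (a : ℝ) : ‖phaseMean a‖ ≤ 1 := by
  have := intervalIntegral.norm_integral_le_of_norm_le_const (a := -1) (b := 0) (C := 1)
    (f := fun s : ℝ => Complex.exp (Complex.I * ((s * a : ℝ) : ℂ)))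
    (fun s _ => by rw [Complex.norm_exp_I_mul_ofReal])
  simpa [phaseMean] using this

theorem abs_mul_norm_phaseMean_le (a : ℝ) : |a| * ‖phaseMean a‖ ≤ 2 := by
  rcases eq_or_ne a 0 with rfl | ha
  · simp
  have h : ‖1 - Complex.exp (-(Complex.I * a))‖ ≤ 2 := by
    refine (norm_sub_le _ _).trans ?_
    have : ‖Complex.exp (-(Complex.I * a))‖ = 1 := by
      have := Complex.norm_exp_I_mul_ofReal (-a)
      push_cast at this
      rwa [mul_neg] at this
    rw [this, norm_one]
    norm_num
  have ha' := abs_pos.mpr ha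
  rw [phaseMean_eq ha, norm_div, norm_mul, Complex.norm_I, one_mul, Complex.norm_real,
    Real.norm_eq_abs, mul_div_cancel₀ _ ha'.ne']
  exact h

theorem im_phaseMean {a : ℝ} (ha : a ≠ 0) : (phaseMean a).im = -(1 - Real.cos a) / a := by
  have h : phaseMean a = (1 - Complex.exp (-(Complex.I * a))) * -Complex.I / a := by
    have : (a : ℂ) ≠ 0 := Complex.ofReal_ne_zero.mpr ha
    rw [phaseMean_eq ha]
    field_simp
    ring_nf
    simp
    ring
  have h2 : Complex.exp (-(Complex.I * a)) = Real.cos a - Real.sin a * Complex.I := by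
    rw [show -(Complex.I * a) = ((-a : ℝ) : ℂ) * Complex.I by push_cast; ring, Complex.exp_mul_I]
    simp [sub_eq_add_neg]
  rw [h, Complex.div_ofReal_im, h2]
  simp
  rfl

theorem continuous_phaseMean : Continuous phaseMean :=
  intervalIntegral.continuous_parametric_intervalIntegral_of_continuous' (by fun_prop) _ _

theorem zetaRHat_travelling_eq_phaseMean (μ : ℝ) (f : ℝ → ℂ) (t ξ : ℝ) :
    zetaRHat μ (travelling f) t ξ =
      Complex.exp (-(Complex.I * t * ξ)) * (-(Complex.I / 2) *
        (((ξ * omega (√μ * ξ) : ℝ) : ℂ) * hat f ξ *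
          (t * phaseMean (t * (ξ * (omega (√μ * ξ) - 1)))))) := by
  rw [zetaRHat_travelling, ← integral_exp_phase]
  simp_rw [mul_assoc _ ξ]
  ring

theorem norm_exp_neg_I_mul (t ξ : ℝ) : ‖Complex.exp (-(Complex.I * t * ξ))‖ = 1 := by
  have := Complex.norm_exp_I_mul_ofReal (-(t * ξ))
  push_cast at this
  rwa [mul_neg, ← mul_assoc] at this

theorem norm_zetaRHat_travelling (μ : ℝ) (f : ℝ → ℂ) {t : ℝ} (ht : 0 ≤ t) (ξ : ℝ) :
    ‖zetaRHat μ (travelling f) t ξ‖ =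
      |ξ| * omega (√μ * ξ) * ‖hat f ξ‖ *
        (t * ‖phaseMean (t * (ξ * (omega (√μ * ξ) - 1)))‖) / 2 := by
  rw [zetaRHat_travelling_eq_phaseMean, norm_mul, norm_exp_neg_I_mul]
  simp only [norm_mul, Complex.norm_real, norm_neg, norm_div, Complex.norm_I, Complex.norm_ofNat,
    Real.norm_eq_abs, abs_of_nonneg ht, abs_of_nonneg (omega_nonneg _)]
  ring

theorem measurable_zetaRHat_travelling (μ : ℝ) {f : ℝ → ℂ} (hf : Integrable f) (t : ℝ) :
    Measurable (zetaRHat μ (travelling f) t) := by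
  rw [funext (zetaRHat_travelling_eq_phaseMean μ f t)]
  have h1 := (continuous_hat hf).measurable
  have h2 := continuous_phaseMean.measurable
  have h3 := measurable_omega
  fun_prop

/-! ### The `H¹` norm in terms of `hat`. -/

/-- Both sides have the same integrals against test functions: the `L²` transform by its
compatibility with tempered distributions, the integral transform by Fubini. -/
theorem fourier_toLp_ae_eq {f : ℝ → ℂ} (hf : Integrable f) (hf2 : MemLp f 2 volume) :
    ((𝓕 (hf2.toLp f) : Lp ℂ 2 (volume : Measure ℝ)) : ℝ → ℂ) =ᵐ[volume] 𝓕 f := by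
  refine ae_eq_of_integral_contDiff_smul_eq ((Lp.memLp _).locallyIntegrable (by norm_num))
    (continuous_fourier_of_integrable hf).locallyIntegrable fun g g_smooth g_cpt => ?_
  have hg₁ : HasCompactSupport (Complex.ofRealCLM ∘ g) := g_cpt.comp_left rfl
  have hg₂ : ContDiff ℝ (⊤ : ℕ∞) (Complex.ofRealCLM ∘ g) := by fun_prop
  set φ := hg₁.toSchwartzMap hg₂ with hφ
  have hφg : ∀ x, φ x = (g x : ℂ) := fun x => rfl
  have h1 := congrArg (fun u : 𝓢'(ℝ, ℂ) => u φ)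
    (Lp.fourier_toTemperedDistribution_eq (hf2.toLp f))
  simp only [TemperedDistribution.fourier_apply, Lp.toTemperedDistribution_apply] at h1
  have h2 : ∫ x, 𝓕 φ x • (hf2.toLp f : ℝ → ℂ) x = ∫ x, (𝓕 (φ : ℝ → ℂ)) x • f x := by
    refine integral_congr_ae ?_
    filter_upwards [hf2.coeFn_toLp] with x hx
    rw [hx, SchwartzMap.fourier_coe]
  have h3 : ∫ x, (𝓕 (φ : ℝ → ℂ)) x • f x = ∫ x, φ x • 𝓕 f x := by
    have := VectorFourier.integral_fourierIntegral_smul_eq_flip (L := innerₗ ℝ) (μ := volume)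
      (ν := volume) (f := φ) (g := f) Real.continuous_fourierChar (by fun_prop) φ.integrable hf
    rwa [flip_innerₗ] at this
  have h4 := h1.symm.trans (h2.trans h3)
  simpa only [hφg, Complex.real_smul, smul_eq_mul] using h4

/-- Membership provides `g ∈ L²` equal, as a distribution, to `(1 + x²)^(1/2)` times the transform.
Multiplying by the inverse weight `w` and using that `L²` embeds injectively in distributions
identifies the transform with `w g`. The weights compare by `√(1 + (2πx)²) ≤ 2π√(1 + x²)`. -/
theorem eH1Norm_ne_top {f : ℝ → ℂ} (hf : MemH1 f) : eH1Norm f ≠ ⊤ := by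
  obtain ⟨hf2, hs⟩ := hf
  obtain ⟨g, hg⟩ := TemperedDistribution.memSobolev_iff_exists_smulLeftCLM_fourier.mp hs
  have hvg : (fun x : ℝ => (((1 + ‖x‖ ^ 2) ^ (1 / 2 : ℝ) : ℝ) : ℂ)).HasTemperateGrowth := by
    fun_prop
  rw [Lp.fourier_toTemperedDistribution_eq] at hg
  set w : ℝ → ℂ := fun x => (((1 + ‖x‖ ^ 2) ^ (-1 / 2 : ℝ) : ℝ) : ℂ) with hw
  have hwg : w.HasTemperateGrowth := by fun_prop
  have hwn : ∀ x, ‖w x‖ ≤ 1 := fun x => by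
    rw [hw, Complex.norm_real, Real.norm_of_nonneg (by positivity)]
    exact Real.rpow_le_one_of_one_le_of_nonpos (by simp [sq_nonneg]) (by norm_num)
  have hwm : MemLp w ⊤ (volume : Measure ℝ) :=
    memLp_top_of_bound hwg.1.continuous.aestronglyMeasurable 1 (Eventually.of_forall hwn)
  have h1 : ((hwm.toLp w • g : Lp ℂ 2 (volume : Measure ℝ)) : 𝓢'(ℝ, ℂ)) =
      ((𝓕 (hf2.toLp f) : Lp ℂ 2 (volume : Measure ℝ)) : 𝓢'(ℝ, ℂ)) := by
    have hprod : (fun x : ℝ => (((1 + ‖x‖ ^ 2) ^ (1 / 2 : ℝ) : ℝ) : ℂ)) * w = fun _ => 1 := by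
      ext x
      rw [Pi.mul_apply, hw]
      simp only
      rw [← Complex.ofReal_mul, ← Real.rpow_add (by positivity)]
      norm_num
    rw [MeasureTheory.Lp.toTemperedDistribution_smul_eq hwg, ← hg,
      TemperedDistribution.smulLeftCLM_smulLeftCLM_apply hvg hwg, hprod,
      TemperedDistribution.smulLeftCLM_const, one_smul]
  have h2 := LinearMap.ker_eq_bot.mp
    (Lp.ker_toTemperedDistributionCLM_eq_bot (F := ℂ) (μ := (volume : Measure ℝ)) (p := 2)) h1
  rw [eH1Norm, dif_pos hf2, ← h2]
  refine (MemLp.of_le_mul (c := 2 * Real.pi) (Lp.memLp g) ?_ ?_).2.ne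
  · refine AEStronglyMeasurable.mul ?_ (Lp.aestronglyMeasurable _)
    exact Continuous.aestronglyMeasurable (by fun_prop)
  · filter_upwards [Lp.coeFn_lpSMul (r := 2) (hwm.toLp w) g, hwm.coeFn_toLp] with x hx hx'
    rw [hx, Pi.smul_apply', hx', smul_eq_mul, ← mul_assoc, norm_mul]
    gcongr
    rw [hw, ← Complex.ofReal_mul, Complex.norm_real, Real.norm_of_nonneg (by positivity)]
    have hp : (1 + ‖x‖ ^ 2) ^ (-1 / 2 : ℝ) = (√(1 + x ^ 2))⁻¹ := by
      rw [Real.sqrt_eq_rpow, ← Real.rpow_neg (by positivity), Real.norm_eq_abs, sq_abs]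
      norm_num
    have hpos : 0 < √(1 + x ^ 2) := Real.sqrt_pos.mpr (by positivity)
    rw [hp, ← div_eq_mul_inv, div_le_iff₀ hpos]
    refine Real.sqrt_le_iff.mpr ⟨by positivity, ?_⟩
    rw [mul_pow, mul_pow _ √_, Real.sq_sqrt (by positivity)]
    nlinarith [Real.pi_gt_three]

theorem lintegral_eq_mul_lintegral_comp_mul_left {a : ℝ} (ha : 0 < a) (F : ℝ → ℝ≥0∞) :
    ∫⁻ x, F x = ENNReal.ofReal a * ∫⁻ x, F (a * x) := by
  conv_lhs => rw [← Real.smul_map_volume_mul_left ha.ne', abs_of_pos ha]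
  rw [lintegral_smul_measure, smul_eq_mul]
  congr 1
  exact lintegral_map_equiv F (Homeomorph.mulLeft₀ a ha.ne').toMeasurableEquiv

theorem lintegral_enorm_mul_hat_sq_le {f : ℝ → ℂ} (hf : Integrable f) :
    ∫⁻ ξ, ‖√(1 + ξ ^ 2) * ‖hat f ξ‖‖ₑ ^ 2 ≤ eH1Norm f ^ 2 := by
  by_cases hf2 : MemLp f 2 (volume : Measure ℝ)
  swap
  · simp [eH1Norm, dif_neg hf2]
  have hπ : (0 : ℝ) < 2 * Real.pi := by positivity
  have e : eH1Norm f ^ 2 = ∫⁻ ξ, ‖√(1 + (2 * Real.pi * ξ) ^ 2) * ‖𝓕 f ξ‖‖ₑ ^ 2 := by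
    rw [eH1Norm, dif_pos hf2, eLpNorm_eq_lintegral_rpow_enorm_toReal (by norm_num) (by norm_num)]
    simp only [ENNReal.toReal_ofNat, ENNReal.rpow_ofNat, ← ENNReal.rpow_mul_natCast]
    norm_num
    refine lintegral_congr_ae ?_
    filter_upwards [fourier_toLp_ae_eq hf hf2] with ξ hξ
    rw [hξ, ← ofReal_norm (Complex.ofReal _), Complex.norm_real, ofReal_norm]
  rw [e, lintegral_eq_mul_lintegral_comp_mul_left hπ, ← lintegral_const_mul' _ _ ENNReal.ofReal_ne_top]
  refine lintegral_mono fun ξ => ?_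
  have h : ‖hat f (2 * Real.pi * ξ)‖ = (2 * Real.pi)⁻¹ * ‖𝓕 f ξ‖ := by
    rw [hat_eq_fourier, mul_div_cancel_left₀ _ hπ.ne', norm_mul, norm_inv, Complex.norm_real,
      Real.norm_of_nonneg hπ.le]
  rw [h, ← enorm_pow, ← enorm_pow, Real.enorm_of_nonneg (by positivity),
    Real.enorm_of_nonneg (by positivity), ← ENNReal.ofReal_mul hπ.le]
  refine ENNReal.ofReal_le_ofReal ?_
  -- The dilation contributes `2π` and the squared normalisation of `hat` contributes `(2π)⁻²`; the
  -- net factor is below `1`.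
  have : 2 * Real.pi * (√(1 + (2 * Real.pi * ξ) ^ 2) * ((2 * Real.pi)⁻¹ * ‖𝓕 f ξ‖)) ^ 2 =
      (2 * Real.pi)⁻¹ * (√(1 + (2 * Real.pi * ξ) ^ 2) * ‖𝓕 f ξ‖) ^ 2 := by
    field_simp
  rw [this]
  refine mul_le_of_le_one_left (by positivity) (inv_le_one_of_one_le₀ ?_)
  linarith [Real.pi_gt_three]

/-! ### Low- and high-frequency bounds. -/

theorem lintegral_inv_one_add_mul_sq {a : ℝ} (ha : 0 < a) :
    ∫⁻ x, ENNReal.ofReal ((1 + (a * x) ^ 2)⁻¹) = ENNReal.ofReal (Real.pi / a) := by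
  have h := lintegral_eq_mul_lintegral_comp_mul_left (inv_pos.mpr ha)
    (fun x => ENNReal.ofReal ((1 + (a * x) ^ 2)⁻¹))
  simp only [mul_inv_cancel_left₀ ha.ne'] at h
  rw [h, ← ofReal_integral_eq_lintegral_ofReal integrable_inv_one_add_sq
    (Eventually.of_forall fun x => by positivity), integral_univ_inv_one_add_sq,
    ← ENNReal.ofReal_mul (by positivity)]
  congr 1
  field_simp

/-- Turns the two bounds on the phase mean into one integrable majorant. The `48 = 2 · 24` comes
from `|a|‖phaseMean a‖ ≤ 2` and `1 - ω ≥ x²/24`; splitting at `z = 4` shows that `98` is more than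
enough. -/
theorem mul_min_le_div {z : ℝ} (hz : 0 ≤ z) {p : ℝ} (h1 : p ≤ 1) (h2 : z ^ 3 * p ≤ 48) :
    z * p ≤ 98 * (1 + z ^ 2)⁻¹ := by
  rw [← div_eq_mul_inv, le_div_iff₀ (by positivity)]
  rcases le_total z 4 with h | h
  · nlinarith [mul_nonneg hz hz, mul_le_mul_of_nonneg_left h1 hz, mul_le_mul_of_nonneg_left h hz]
  · by_cases hp : 0 ≤ p
    · nlinarith [mul_nonneg hz hp]
    · nlinarith [mul_nonneg hz hz, mul_nonneg hz (neg_nonneg.mpr (not_le.mp hp).le)]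

/-- On low frequencies the phase mean decays like that of the cubic phase. -/
theorem abs_mul_norm_phaseMean_le_of_low {μ t r ξ : ℝ} (hr : 0 < r) (hμ : 0 ≤ μ) (ht : 0 ≤ t)
    (hrt : r ^ 3 = μ * t)
    (hξ : |√μ * ξ| ≤ 1) :
    |ξ| * ‖phaseMean (t * (ξ * (omega (√μ * ξ) - 1)))‖ ≤ 98 / r * (1 + (r * ξ) ^ 2)⁻¹ := by
  have h1 := norm_phaseMean_le_one (t * (ξ * (omega (√μ * ξ) - 1)))
  have h2 := abs_mul_norm_phaseMean_le (t * (ξ * (omega (√μ * ξ) - 1)))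
  have h3 := sq_div_le_one_sub_omega hξ
  rw [mul_pow, Real.sq_sqrt hμ] at h3
  set p := ‖phaseMean (t * (ξ * (omega (√μ * ξ) - 1)))‖
  have hp : 0 ≤ p := norm_nonneg _
  have h4 : (r * |ξ|) ^ 3 / 24 ≤ |t * (ξ * (omega (√μ * ξ) - 1))| := by
    rw [abs_mul, abs_mul, abs_of_nonneg ht, abs_of_nonpos (show omega (√μ * ξ) - 1 ≤ 0 by linarith [omega_le_one (√μ * ξ)]),
      mul_pow, hrt]
    calc μ * t * |ξ| ^ 3 / 24 = t * (|ξ| * (μ * ξ ^ 2 / 24)) := by rw [← sq_abs ξ]; ring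
      _ ≤ _ := by gcongr; linarith
  have h5 := mul_min_le_div (z := r * |ξ|) (by positivity) h1
    (by nlinarith [mul_le_mul_of_nonneg_right h4 hp])
  rw [mul_pow, sq_abs, ← mul_pow] at h5
  rw [div_mul_eq_mul_div, le_div_iff₀ hr]
  linarith

theorem norm_zetaRHat_le_of_low (f : ℝ → ℂ) {μ t r ξ : ℝ} (hr : 0 < r) (hμ : 0 ≤ μ) (ht : 0 ≤ t)
    (hrt : r ^ 3 = μ * t) (hξ : |√μ * ξ| ≤ 1) :
    ‖zetaRHat μ (travelling f) t ξ‖ ≤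
      8 * t / r * (∫ X, ‖f X‖) * (1 + (r * ξ) ^ 2)⁻¹ := by
  have h1 := abs_mul_norm_phaseMean_le_of_low hr hμ ht hrt hξ
  have h2 := norm_hat_le f ξ
  have hM : 0 ≤ ∫ X, ‖f X‖ := integral_nonneg fun _ => norm_nonneg _
  rw [norm_zetaRHat_travelling μ f ht]
  have hπ : (2 * Real.pi)⁻¹ ≤ 1 / 6.25 := by
    rw [inv_eq_one_div]
    gcongr
    have := Real.pi_gt_d2
    linarith
  calc _ = omega (√μ * ξ) * ‖hat f ξ‖ *
        (|ξ| * ‖phaseMean (t * (ξ * (omega (√μ * ξ) - 1)))‖) * t / 2 := by ring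
    _ ≤ 1 * ((1 / 6.25) * ∫ X, ‖f X‖) * (98 / r * (1 + (r * ξ) ^ 2)⁻¹) * t / 2 := by
        gcongr
        · exact omega_le_one _
        · exact h2.trans (by gcongr)
    _ = 7.84 * (t / r * (∫ X, ‖f X‖) * (1 + (r * ξ) ^ 2)⁻¹) := by ring
    _ ≤ 8 * (t / r * (∫ X, ‖f X‖) * (1 + (r * ξ) ^ 2)⁻¹) := by gcongr; norm_num
    _ = _ := by ring

/-- The phase is at least `t|ξ|/24`, so the decay of the phase mean cancels the factor `t|ξ|` and
leaves a bound independent of `t`. -/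
theorem norm_zetaRHat_le_of_high (f : ℝ → ℂ) {μ t ξ : ℝ} (ht : 0 ≤ t) (hξ : 1 ≤ |√μ * ξ|) :
    ‖zetaRHat μ (travelling f) t ξ‖ ≤ 24 * (omega (√μ * ξ) * ‖hat f ξ‖) := by
  have h2 := abs_mul_norm_phaseMean_le (t * (ξ * (omega (√μ * ξ) - 1)))
  have h3 := le_one_sub_omega hξ
  rw [norm_zetaRHat_travelling μ f ht]
  set p := ‖phaseMean (t * (ξ * (omega (√μ * ξ) - 1)))‖
  have hp : 0 ≤ p := norm_nonneg _
  rw [abs_mul, abs_mul, abs_of_nonneg ht, abs_of_nonpos (show omega (√μ * ξ) - 1 ≤ 0 by linarith)] at h2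
  have h4 : |ξ| * (t * p) ≤ 48 := by
    have h : 0 ≤ |ξ| * (t * p) := by positivity
    nlinarith [mul_le_mul_of_nonneg_left h3 h]
  calc _ = omega (√μ * ξ) * ‖hat f ξ‖ * (|ξ| * (t * p)) / 2 := by ring
    _ ≤ omega (√μ * ξ) * ‖hat f ξ‖ * 48 / 2 := by
        have := omega_nonneg (√μ * ξ)
        gcongr
    _ = _ := by ring

/-- The low frequencies, for which `√μ ξ` is at most `1`. -/
def lowFrequencies (μ : ℝ) : Set ℝ := {ξ | |√μ * ξ| ≤ 1}

theorem measurableSet_lowFrequencies (μ : ℝ) : MeasurableSet (lowFrequencies μ) :=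
  measurableSet_le (by fun_prop) measurable_const

theorem setLIntegral_low_le (f : ℝ → ℂ) {μ t r : ℝ} (hr : 0 < r) (hμ : 0 ≤ μ) (ht : 0 ≤ t)
    (hrt : r ^ 3 = μ * t) :
    ∫⁻ ξ in lowFrequencies μ, ‖zetaRHat μ (travelling f) t ξ‖ₑ ≤
      ENNReal.ofReal (8 * t / r * (∫ X, ‖f X‖) * (Real.pi / r)) := by
  have hM : 0 ≤ ∫ X, ‖f X‖ := integral_nonneg fun _ => norm_nonneg _
  rw [ENNReal.ofReal_mul (by positivity), ← lintegral_inv_one_add_mul_sq hr,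
    ← lintegral_const_mul' _ _ ENNReal.ofReal_ne_top]
  refine (setLIntegral_mono' (measurableSet_lowFrequencies μ) fun ξ hξ => ?_).trans
    (setLIntegral_le_lintegral _ _)
  rw [← ENNReal.ofReal_mul (by positivity), ← ofReal_norm]
  exact ENNReal.ofReal_le_ofReal (norm_zetaRHat_le_of_low f hr hμ ht hrt hξ)

/-- Where `μξ² > 1`, `1 ≤ 2μ(1 + ξ²)/(1 + μξ²)`. Cauchy–Schwarz then pairs the `H¹` density with
`2μ/(1 + μξ²)`, whose integral `2π√μ` has square root of order `μ^(1/4)`. -/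
theorem setLIntegral_high_le {f : ℝ → ℂ} (hf : Integrable f) {μ t : ℝ} (hμ : 0 < μ) (ht : 0 ≤ t) :
    ∫⁻ ξ in (lowFrequencies μ)ᶜ, ‖zetaRHat μ (travelling f) t ξ‖ₑ ≤
      ENNReal.ofReal (100 * μ ^ (1 / 4 : ℝ)) * eH1Norm f := by
  have hs : 0 < √μ := Real.sqrt_pos.mpr hμ
  set a : ℝ → ℝ≥0∞ := fun ξ => ENNReal.ofReal (2 * μ) * ENNReal.ofReal ((1 + (√μ * ξ) ^ 2)⁻¹)
  set b : ℝ → ℝ≥0∞ := fun ξ => ‖√(1 + ξ ^ 2) * ‖hat f ξ‖‖ₑ ^ 2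
  have hpt : ∀ ξ ∈ (lowFrequencies μ)ᶜ, ‖zetaRHat μ (travelling f) t ξ‖ₑ ≤
      24 * (a ξ ^ (1 / 2 : ℝ) * b ξ ^ (1 / 2 : ℝ)) := fun ξ hξ => by
    have hξ' : 1 < |√μ * ξ| := not_le.mp hξ
    have ha : a ξ ^ (1 / 2 : ℝ) = ENNReal.ofReal (√(2 * μ * (1 + (√μ * ξ) ^ 2)⁻¹)) := by
      rw [Real.sqrt_eq_rpow, ← ENNReal.ofReal_rpow_of_nonneg (by positivity) (by norm_num),
        ENNReal.ofReal_mul (by positivity)]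
    have hb : b ξ ^ (1 / 2 : ℝ) = ENNReal.ofReal (√(1 + ξ ^ 2) * ‖hat f ξ‖) := by
      rw [← ENNReal.rpow_natCast_mul]
      rw [← Real.enorm_of_nonneg (by positivity)]
      norm_num
    rw [ha, hb, ← ENNReal.ofReal_mul (by positivity), show (24 : ℝ≥0∞) = ENNReal.ofReal 24 by simp,
      ← ENNReal.ofReal_mul (by positivity), ← ofReal_norm]
    refine ENNReal.ofReal_le_ofReal ((norm_zetaRHat_le_of_high f ht hξ'.le).trans ?_)
    rw [← mul_assoc (√_)]
    gcongr
    refine abs_le_of_sq_le_sq' ?_ (by positivity) |>.2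
    rw [mul_pow, Real.sq_sqrt (by positivity), Real.sq_sqrt (by positivity)]
    have h2 : (√μ * ξ) ^ 2 = μ * ξ ^ 2 := by rw [mul_pow, Real.sq_sqrt hμ.le]
    have h3 : 1 < μ * ξ ^ 2 := by
      rw [← h2, ← sq_abs]
      nlinarith
    calc omega (√μ * ξ) ^ 2 ≤ 1 := omega_sq_le_one _
      _ ≤ 2 * μ * (1 + (√μ * ξ) ^ 2)⁻¹ * (1 + ξ ^ 2) := by
        rw [h2, ← div_eq_mul_inv, div_mul_eq_mul_div, one_le_div (by positivity)]
        nlinarith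
  have hbm : Measurable b := by
    have := (continuous_hat hf).measurable
    fun_prop
  calc _ ≤ ∫⁻ ξ in (lowFrequencies μ)ᶜ, 24 * (a ξ ^ (1 / 2 : ℝ) * b ξ ^ (1 / 2 : ℝ)) :=
        setLIntegral_mono' (measurableSet_lowFrequencies μ).compl hpt
    _ ≤ ∫⁻ ξ, 24 * (a ξ ^ (1 / 2 : ℝ) * b ξ ^ (1 / 2 : ℝ)) := setLIntegral_le_lintegral _ _
    _ = 24 * ∫⁻ ξ, a ξ ^ (1 / 2 : ℝ) * b ξ ^ (1 / 2 : ℝ) := lintegral_const_mul' _ _ (by simp)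
    _ ≤ 24 * ((∫⁻ ξ, a ξ) ^ (1 / 2 : ℝ) * (∫⁻ ξ, b ξ) ^ (1 / 2 : ℝ)) := by
        gcongr
        exact ENNReal.lintegral_mul_norm_pow_le (by fun_prop) hbm.aemeasurable
          (by norm_num) (by norm_num) (by norm_num)
    _ ≤ 24 * (ENNReal.ofReal (4 * μ ^ (1 / 4 : ℝ)) * eH1Norm f) := by
        gcongr
        · rw [lintegral_const_mul' _ _ ENNReal.ofReal_ne_top, lintegral_inv_one_add_mul_sq hs,
            ← ENNReal.ofReal_mul (by positivity),
            ENNReal.ofReal_rpow_of_nonneg (by positivity) (by norm_num)]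
          refine ENNReal.ofReal_le_ofReal ?_
          rw [← Real.sqrt_eq_rpow]
          refine Real.sqrt_le_iff.mpr ⟨by positivity, ?_⟩
          have h1 : (μ ^ (1 / 4 : ℝ)) ^ 2 = √μ := by
            rw [Real.sqrt_eq_rpow, ← Real.rpow_mul_natCast hμ.le]
            norm_num
          have h2 : 2 * μ * (Real.pi / √μ) = 2 * Real.pi * √μ := by
            field_simp
            rw [Real.sq_sqrt hμ.le]
          rw [mul_pow, h1, h2]
          gcongr
          linarith [Real.pi_le_four]
        · refine (ENNReal.rpow_le_rpow (lintegral_enorm_mul_hat_sq_le hf) (by norm_num)).trans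
            (le_of_eq ?_)
          rw [← ENNReal.rpow_natCast_mul]
          norm_num
    _ ≤ _ := by
        rw [← mul_assoc]
        gcongr
        rw [show (24 : ℝ≥0∞) = ENNReal.ofReal 24 by simp, ← ENNReal.ofReal_mul (by positivity)]
        refine ENNReal.ofReal_le_ofReal ?_
        have : 0 ≤ μ ^ (1 / 4 : ℝ) := by positivity
        linarith

/-! ### The limiting profile and its nonzero integral. -/

/-- The profile of the rescaled resonance on the Fourier side. -/
noncomputable def airyProfile (η : ℝ) : ℂ := η * phaseMean (-η ^ 3 / 6)

theorem continuous_airyProfile : Continuous airyProfile := by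
  have := continuous_phaseMean
  unfold airyProfile
  fun_prop

theorem integrable_airyProfile : Integrable airyProfile := by
  refine (integrable_inv_one_add_sq.const_mul 98).mono'
    continuous_airyProfile.aestronglyMeasurable (Eventually.of_forall fun η => ?_)
  have h := abs_mul_norm_phaseMean_le (-η ^ 3 / 6)
  rw [abs_div, abs_neg, abs_pow, abs_of_pos (show (0 : ℝ) < 6 by norm_num)] at h
  have := mul_min_le_div (abs_nonneg η) (norm_phaseMean_le_one (-η ^ 3 / 6)) (by linarith)
  rwa [sq_abs, ← Real.norm_eq_abs, ← Complex.norm_real, ← norm_mul] at this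

theorem im_airyProfile {η : ℝ} (hη : η ≠ 0) :
    (airyProfile η).im = 6 * (1 - Real.cos (-η ^ 3 / 6)) / η ^ 2 := by
  have : -η ^ 3 / 6 ≠ 0 := by
    have := pow_ne_zero 3 hη
    intro h
    apply this
    linarith
  rw [airyProfile, Complex.im_ofReal_mul, im_phaseMean this]
  field_simp

theorem integral_airyProfile_ne_zero : ∫ η, airyProfile η ≠ 0 := by
  have him : 0 < ∫ η, (airyProfile η).im := by
    refine integral_pos_of_integrable_nonneg_nonzero (x := 1)
      (Complex.continuous_im.comp continuous_airyProfile) integrable_airyProfile.im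
      (fun η => ?_) ?_
    · simp only [Pi.zero_apply]
      rcases eq_or_ne η 0 with rfl | hη
      · simp [airyProfile]
      · rw [im_airyProfile hη]
        have := Real.cos_le_one (-η ^ 3 / 6)
        have : 0 ≤ 1 - Real.cos (-η ^ 3 / 6) := by linarith
        positivity
    · rw [im_airyProfile one_ne_zero]
      have h := Real.cos_lt_cos_of_nonneg_of_le_pi (x := 0) (y := 1 / 6) le_rfl
        (by linarith [Real.pi_gt_three]) (by norm_num)
      rw [Real.cos_zero] at h
      have e : (-(1 : ℝ) ^ 3 / 6) = -(1 / 6) := by norm_num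
      rw [e, Real.cos_neg]
      refine ne_of_gt ?_
      have : 0 < 1 - Real.cos (1 / 6) := by linarith
      positivity
  intro h
  have := Complex.imCLM.integral_comp_comm integrable_airyProfile
  simp only [Complex.imCLM_apply, h, Complex.zero_im] at this
  exact him.ne' this

/-! ### Integrability, continuity and the upper bound. -/

theorem continuous_invHat {g : ℝ → ℂ} (hg : Integrable g) : Continuous (invHat g) := by
  have hn : ∀ X ξ : ℝ, ‖Complex.exp (Complex.I * X * ξ)‖ = 1 := fun X ξ => by
    rw [mul_assoc, ← Complex.ofReal_mul, Complex.norm_exp_I_mul_ofReal]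
  refine continuous_of_dominated (bound := fun ξ => ‖g ξ‖) (fun X => ?_) (fun X => ?_) hg.norm ?_
  · exact (Continuous.aestronglyMeasurable (by fun_prop)).mul hg.1
  · exact Eventually.of_forall fun ξ => by rw [norm_mul, hn, one_mul]
  · exact Eventually.of_forall fun ξ => by fun_prop

theorem enorm_invHat_le (g : ℝ → ℂ) (X : ℝ) : ‖invHat g X‖ₑ ≤ ∫⁻ ξ, ‖g ξ‖ₑ := by
  refine (enorm_integral_le_lintegral_enorm _).trans (le_of_eq (lintegral_congr fun ξ => ?_))
  rw [enorm_mul, ← ofReal_norm, mul_assoc, ← Complex.ofReal_mul, Complex.norm_exp_I_mul_ofReal]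
  simp

/-- A nonempty open set has positive measure. This lets the value at the single point `X = t` bound
the essential supremum from below. -/
theorem enorm_le_eLpNorm_top {f : ℝ → ℂ} (hf : Continuous f) (X : ℝ) :
    ‖f X‖ₑ ≤ eLpNorm f ∞ volume := by
  by_contra! h
  have ho : IsOpen {x | eLpNorm f ∞ volume < ‖f x‖ₑ} := isOpen_lt continuous_const hf.enorm
  have hz : volume {x | eLpNorm f ∞ volume < ‖f x‖ₑ} = 0 := by
    have := enorm_ae_le_eLpNormEssSup f volume
    rw [eLpNorm_exponent_top]
    simpa [ae_iff, not_le] using this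
  exact (ho.measure_pos volume ⟨X, h⟩).ne' hz

/-- The transform of the travelling resonance seen from the point `X = t`, without the factor
`-i/2`. -/
noncomputable def comovingHat (μ : ℝ) (f : ℝ → ℂ) (t ξ : ℝ) : ℂ :=
  ((ξ * omega (√μ * ξ) : ℝ) : ℂ) * hat f ξ * (t * phaseMean (t * (ξ * (omega (√μ * ξ) - 1))))

theorem norm_comovingHat (μ : ℝ) (f : ℝ → ℂ) (t ξ : ℝ) :
    ‖comovingHat μ f t ξ‖ = 2 * ‖zetaRHat μ (travelling f) t ξ‖ := by
  rw [zetaRHat_travelling_eq_phaseMean, norm_mul, norm_exp_neg_I_mul, norm_mul, comovingHat]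
  simp

theorem measurable_comovingHat (μ : ℝ) {f : ℝ → ℂ} (hf : Integrable f) (t : ℝ) :
    Measurable (comovingHat μ f t) := by
  have h1 := (continuous_hat hf).measurable
  have h2 := continuous_phaseMean.measurable
  have h3 := measurable_omega
  unfold comovingHat
  fun_prop

theorem zetaR_travelling_self (μ : ℝ) (f : ℝ → ℂ) (t : ℝ) :
    zetaR μ (travelling f) t t = -(Complex.I / 2) * ∫ ξ, comovingHat μ f t ξ := by
  rw [zetaR, invHat, ← integral_const_mul]
  congr 1 with ξ
  rw [zetaRHat_travelling_eq_phaseMean, ← mul_assoc, ← Complex.exp_add, comovingHat]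
  simp

theorem cube_rpow_third {x : ℝ} (hx : 0 ≤ x) : (x ^ (1 / 3 : ℝ)) ^ 3 = x := by
  rw [← Real.rpow_mul_natCast hx]
  norm_num

theorem integrable_zetaRHat_travelling {μ : ℝ} (hμ : 0 < μ) {f : ℝ → ℂ} (hf : Integrable f)
    (hf1 : eH1Norm f ≠ ⊤) {t : ℝ} (ht : 0 < t) :
    Integrable (zetaRHat μ (travelling f) t) := by
  refine ⟨(measurable_zetaRHat_travelling μ hf t).aestronglyMeasurable, ?_⟩
  have hr : 0 < (μ * t) ^ (1 / 3 : ℝ) := by positivity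
  rw [HasFiniteIntegral, ← lintegral_add_compl _ (measurableSet_lowFrequencies μ)]
  refine ENNReal.add_lt_top.mpr ⟨?_, ?_⟩
  · exact (setLIntegral_low_le f hr hμ.le ht.le (cube_rpow_third (by positivity))).trans_lt
      ENNReal.ofReal_lt_top
  · exact (setLIntegral_high_le hf hμ ht.le).trans_lt (ENNReal.mul_lt_top ENNReal.ofReal_lt_top
      hf1.lt_top)

theorem zetaRHat_zero (μ : ℝ) (P : ℝ → ℝ → ℂ) : zetaRHat μ P 0 = 0 := by
  ext ξ
  simp [zetaRHat]

theorem eLpNorm_zetaR_travelling_le {μ : ℝ} (hμ : 0 < μ) {f : ℝ → ℂ} (hf : Integrable f)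
    {t : ℝ} (ht : 0 ≤ t) :
    eLpNorm (zetaR μ (travelling f) t) ∞ volume ≤
      ENNReal.ofReal (32 * μ ^ (1 / 3 : ℝ) * (t ^ (1 / 3 : ℝ) / μ)) * eLpNorm f 1 volume +
        ENNReal.ofReal (100 * μ ^ (1 / 4 : ℝ)) * eH1Norm f := by
  have hs : eLpNorm (zetaR μ (travelling f) t) ∞ volume ≤
      ∫⁻ ξ, ‖zetaRHat μ (travelling f) t ξ‖ₑ := by
    rw [eLpNorm_exponent_top]
    exact eLpNormEssSup_le_of_ae_enorm_bound
      (Eventually.of_forall fun X => enorm_invHat_le _ X)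
  refine hs.trans ?_
  -- At `t = 0` the scale `r = (μt)^(1/3)` degenerates, but the amplitude is zero.
  rcases ht.eq_or_lt with rfl | ht
  · simp [zetaRHat_zero]
  rw [← lintegral_add_compl _ (measurableSet_lowFrequencies μ)]
  refine add_le_add ?_ (setLIntegral_high_le hf hμ ht.le)
  have hr : 0 < (μ * t) ^ (1 / 3 : ℝ) := by positivity
  refine (setLIntegral_low_le f hr hμ.le ht.le (cube_rpow_third (by positivity))).trans ?_
  rw [eLpNorm_one_eq_lintegral_enorm, ← ofReal_integral_norm_eq_lintegral_enorm hf,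
    ← ENNReal.ofReal_mul (by positivity)]
  refine ENNReal.ofReal_le_ofReal ?_
  have hM : 0 ≤ ∫ X, ‖f X‖ := integral_nonneg fun _ => norm_nonneg _
  rw [Real.mul_rpow hμ.le ht.le]
  have h1 := cube_rpow_third hμ.le
  have h2 := cube_rpow_third ht.le
  have h3 : 0 < μ ^ (1 / 3 : ℝ) := by positivity
  have h4 : 0 < t ^ (1 / 3 : ℝ) := by positivity
  set m := μ ^ (1 / 3 : ℝ)
  set s := t ^ (1 / 3 : ℝ)
  rw [← h1, ← h2]
  calc 8 * s ^ 3 / (m * s) * (∫ X, ‖f X‖) * (Real.pi / (m * s))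
      = 8 * Real.pi * (s / m ^ 2 * ∫ X, ‖f X‖) := by field_simp
    _ ≤ 8 * 4 * (s / m ^ 2 * ∫ X, ‖f X‖) := by
        gcongr
        exact Real.pi_le_four
    _ = _ := by field_simp; ring

/-! ### The limit of the rescaled amplitude at `X = t`. -/

theorem tendsto_scaled_comovingHat {μ : ℝ} (hμ : 0 < μ) {f : ℝ → ℂ} (hf : Integrable f) (η : ℝ) :
    Tendsto (fun t : ℝ => (((μ * t) ^ (1 / 3 : ℝ) / t : ℝ) : ℂ) *
      (lowFrequencies μ).indicator (comovingHat μ f t) (((μ * t) ^ (1 / 3 : ℝ))⁻¹ * η)) atTop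
      (𝓝 (hat f 0 * airyProfile η)) := by
  rcases eq_or_ne η 0 with rfl | hη
  · have : ∀ t : ℝ, (lowFrequencies μ).indicator (comovingHat μ f t) 0 = 0 := fun t => by
      simp [comovingHat]
    simp [this, airyProfile]
  set ξ : ℝ → ℝ := fun t => ((μ * t) ^ (1 / 3 : ℝ))⁻¹ * η with hξ
  have hr : Tendsto (fun t : ℝ => (μ * t) ^ (1 / 3 : ℝ)) atTop atTop :=
    (tendsto_rpow_atTop (by norm_num)).comp (tendsto_id.const_mul_atTop hμ)
  have hξ0 : Tendsto ξ atTop (𝓝 0) := by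
    have := (tendsto_inv_atTop_zero.comp hr).mul_const η
    rwa [zero_mul] at this
  have hx : Tendsto (fun t => √μ * ξ t) atTop (𝓝 0) := by simpa using hξ0.const_mul √μ
  have hx' : Tendsto (fun t => √μ * ξ t) atTop (𝓝[≠] 0) := by
    refine tendsto_nhdsWithin_iff.mpr ⟨hx, ?_⟩
    filter_upwards [eventually_gt_atTop 0] with t ht
    have : 0 < (μ * t) ^ (1 / 3 : ℝ) := by positivity
    have : √μ ≠ 0 := (Real.sqrt_pos.mpr hμ).ne'
    simp only [Set.mem_compl_iff, Set.mem_singleton_iff, hξ]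
    positivity
  have hω : Tendsto (fun t => omega (√μ * ξ t)) atTop (𝓝 1) := by
    have := continuousAt_omega_zero.tendsto.comp hx
    rwa [show omega 0 = 1 by simp [omega]] at this
  have hhat : Tendsto (fun t => hat f (ξ t)) atTop (𝓝 (hat f 0)) :=
    ((continuous_hat hf).tendsto 0).comp hξ0
  have hq : Tendsto (fun t => η ^ 3 * ((omega (√μ * ξ t) - 1) / (√μ * ξ t) ^ 2)) atTop
      (𝓝 (-η ^ 3 / 6)) := by
    have := (tendsto_omega_sub_one_div_sq.comp hx').const_mul (η ^ 3)
    rwa [show η ^ 3 * (-1 / 6) = -η ^ 3 / 6 by ring] at this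
  have hlim : Tendsto (fun t => ((η * omega (√μ * ξ t) : ℝ) : ℂ) * hat f (ξ t) *
      phaseMean (η ^ 3 * ((omega (√μ * ξ t) - 1) / (√μ * ξ t) ^ 2))) atTop
      (𝓝 (((η * 1 : ℝ) : ℂ) * hat f 0 * phaseMean (-η ^ 3 / 6))) :=
    (((Complex.continuous_ofReal.tendsto _).comp (hω.const_mul η)).mul hhat).mul
      ((continuous_phaseMean.tendsto _).comp hq)
  have he : ((η * 1 : ℝ) : ℂ) * hat f 0 * phaseMean (-η ^ 3 / 6) = hat f 0 * airyProfile η := by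
    rw [airyProfile, mul_one]
    ring
  rw [← he]
  refine hlim.congr' ?_
  filter_upwards [eventually_gt_atTop 0, hx.abs.eventually_le_const
    (show |(0 : ℝ)| < 1 by norm_num)] with t ht hlow
  have hmem : ((μ * t) ^ (1 / 3 : ℝ))⁻¹ * η ∈ lowFrequencies μ := hlow
  rw [Set.indicator_of_mem hmem, comovingHat]
  have hr0 : 0 < (μ * t) ^ (1 / 3 : ℝ) := by positivity
  have hr3 := cube_rpow_third (x := μ * t) (by positivity)
  have hξt : ξ t = ((μ * t) ^ (1 / 3 : ℝ))⁻¹ * η := rfl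
  rw [← hξt]
  -- Since `r³ = μt` and `η = r ξ`, one has `t ξ = η³/(μξ²)`, which exposes the quotient with limit
  -- `-1/6`.
  have harg : t * (ξ t * (omega (√μ * ξ t) - 1)) =
      η ^ 3 * ((omega (√μ * ξ t) - 1) / (√μ * ξ t) ^ 2) := by
    have hη' : η = (μ * t) ^ (1 / 3 : ℝ) * ξ t := by rw [hξt]; field_simp
    have hne : ξ t ≠ 0 := by rw [hξt]; positivity
    rw [mul_pow, Real.sq_sqrt hμ.le]
    conv_rhs => rw [hη', mul_pow, hr3]
    field_simp
  rw [harg]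
  have key : (η : ℂ) = (((μ * t) ^ (1 / 3 : ℝ) / t : ℝ) : ℂ) * (ξ t : ℂ) * (t : ℂ) := by
    rw [hξt, ← Complex.ofReal_mul, ← Complex.ofReal_mul]
    congr 1
    field_simp
  rw [Complex.ofReal_mul, Complex.ofReal_mul (ξ t)]
  linear_combination ((omega (√μ * ξ t) : ℂ) * hat f (ξ t) *
    phaseMean (η ^ 3 * ((omega (√μ * ξ t) - 1) / (√μ * ξ t) ^ 2))) * key

theorem tendsto_integral_scaled_comovingHat {μ : ℝ} (hμ : 0 < μ) {f : ℝ → ℂ} (hf : Integrable f) :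
    Tendsto (fun t : ℝ => ∫ η, (((μ * t) ^ (1 / 3 : ℝ) / t : ℝ) : ℂ) *
      (lowFrequencies μ).indicator (comovingHat μ f t) (((μ * t) ^ (1 / 3 : ℝ))⁻¹ * η)) atTop
      (𝓝 (hat f 0 * ∫ η, airyProfile η)) := by
  have hM : 0 ≤ ∫ X, ‖f X‖ := integral_nonneg fun _ => norm_nonneg _
  rw [← integral_const_mul]
  refine tendsto_integral_filter_of_dominated_convergence
    (fun η => 16 * (∫ X, ‖f X‖) * (1 + η ^ 2)⁻¹) (Eventually.of_forall fun t => ?_) ?_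
    (integrable_inv_one_add_sq.const_mul _)
    (Eventually.of_forall fun η => tendsto_scaled_comovingHat hμ hf η)
  · have h := (measurable_comovingHat μ hf t).indicator (measurableSet_lowFrequencies μ)
    exact Measurable.aestronglyMeasurable (by fun_prop)
  · filter_upwards [eventually_gt_atTop 0] with t ht
    refine Eventually.of_forall fun η => ?_
    have hr0 : 0 < (μ * t) ^ (1 / 3 : ℝ) := by positivity
    have hr3 := cube_rpow_third (x := μ * t) (by positivity)
    set r := (μ * t) ^ (1 / 3 : ℝ)
    by_cases hmem : r⁻¹ * η ∈ lowFrequencies μ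
    · rw [Set.indicator_of_mem hmem, norm_mul, norm_comovingHat, Complex.norm_real,
        Real.norm_of_nonneg (by positivity)]
      have := norm_zetaRHat_le_of_low f hr0 hμ.le ht.le hr3 hmem
      rw [mul_inv_cancel_left₀ hr0.ne'] at this
      calc _ ≤ r / t * (2 * (8 * t / r * (∫ X, ‖f X‖) * (1 + η ^ 2)⁻¹)) := by gcongr
        _ = _ := by field_simp; ring
    · rw [Set.indicator_of_notMem hmem, mul_zero, norm_zero]
      positivity

theorem tendsto_norm_zetaR_travelling_self {μ : ℝ} (hμ : 0 < μ) {f : ℝ → ℂ} (hf : Integrable f)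
    (hf1 : eH1Norm f ≠ ⊤) :
    Tendsto (fun t : ℝ => 1 / t ^ (1 / 3 : ℝ) * ‖zetaR μ (travelling f) t t‖) atTop
      (𝓝 (‖∫ η, airyProfile η‖ / 2 / μ ^ (2 / 3 : ℝ) * ‖hat f 0‖)) := by
  set B := (ENNReal.ofReal (100 * μ ^ (1 / 4 : ℝ)) * eH1Norm f).toReal
  set S := lowFrequencies μ
  have hS : MeasurableSet S := measurableSet_lowFrequencies μ
  -- The prefactor `r/t` times the Jacobian `r` of `η = rξ`.
  have hscale : ∀ t : ℝ, 0 < t → ((μ * t) ^ (1 / 3 : ℝ)) ^ 2 / t =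
      μ ^ (2 / 3 : ℝ) * (1 / t ^ (1 / 3 : ℝ)) := fun t ht => by
    have h1 : μ ^ (2 / 3 : ℝ) = (μ ^ (1 / 3 : ℝ)) ^ 2 := by
      rw [← Real.rpow_mul_natCast hμ.le]
      norm_num
    have h2 := cube_rpow_third ht.le
    have h3 : 0 < t ^ (1 / 3 : ℝ) := by positivity
    rw [Real.mul_rpow hμ.le ht.le, h1]
    set s := t ^ (1 / 3 : ℝ)
    rw [← h2]
    field_simp
  have hlow : ∀ t : ℝ, 0 < t → (((μ ^ (2 / 3 : ℝ) * (1 / t ^ (1 / 3 : ℝ)) : ℝ)) : ℂ) *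
      ∫ ξ in S, comovingHat μ f t ξ = ∫ η, (((μ * t) ^ (1 / 3 : ℝ) / t : ℝ) : ℂ) *
      S.indicator (comovingHat μ f t) (((μ * t) ^ (1 / 3 : ℝ))⁻¹ * η) := fun t ht => by
    have hr0 : 0 < (μ * t) ^ (1 / 3 : ℝ) := by positivity
    rw [integral_const_mul, Measure.integral_comp_mul_left, inv_inv, abs_of_pos hr0,
      integral_indicator hS, ← hscale t ht, Complex.real_smul, ← mul_assoc, ← Complex.ofReal_mul]
    congr 2
    ring
  have hhigh : Tendsto (fun t : ℝ => (((μ ^ (2 / 3 : ℝ) * (1 / t ^ (1 / 3 : ℝ)) : ℝ)) : ℂ) *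
      ∫ ξ in Sᶜ, comovingHat μ f t ξ) atTop (𝓝 0) := by
    have h0 : Tendsto (fun t : ℝ => μ ^ (2 / 3 : ℝ) * (1 / t ^ (1 / 3 : ℝ)) * (2 * B)) atTop
        (𝓝 0) := by
      have : Tendsto (fun t : ℝ => 1 / t ^ (1 / 3 : ℝ)) atTop (𝓝 0) := by
        simp_rw [one_div]
        exact tendsto_inv_atTop_zero.comp (tendsto_rpow_atTop (by norm_num))
      simpa using (this.const_mul (μ ^ (2 / 3 : ℝ))).mul_const (2 * B)
    refine squeeze_zero_norm' ?_ h0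
    filter_upwards [eventually_gt_atTop 0] with t ht
    rw [norm_mul, Complex.norm_real, Real.norm_of_nonneg (by positivity)]
    gcongr
    have h1 : ‖∫ ξ in Sᶜ, comovingHat μ f t ξ‖ₑ ≤
        2 * (ENNReal.ofReal (100 * μ ^ (1 / 4 : ℝ)) * eH1Norm f) := by
      refine (enorm_integral_le_lintegral_enorm _).trans ?_
      have : ∀ ξ, ‖comovingHat μ f t ξ‖ₑ = 2 * ‖zetaRHat μ (travelling f) t ξ‖ₑ := fun ξ => by
        rw [← ofReal_norm, norm_comovingHat, ENNReal.ofReal_mul (by norm_num), ofReal_norm]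
        simp
      simp_rw [this]
      rw [lintegral_const_mul' _ _ (by simp)]
      gcongr
      exact setLIntegral_high_le hf hμ ht.le
    have h2 := ENNReal.toReal_mono
      (ENNReal.mul_ne_top (by simp) (ENNReal.mul_ne_top ENNReal.ofReal_ne_top hf1)) h1
    rwa [toReal_enorm, ENNReal.toReal_mul, ENNReal.toReal_ofNat] at h2
  have hsum : Tendsto (fun t : ℝ => (((μ ^ (2 / 3 : ℝ) * (1 / t ^ (1 / 3 : ℝ)) : ℝ)) : ℂ) *
      ∫ ξ, comovingHat μ f t ξ) atTop (𝓝 (hat f 0 * ∫ η, airyProfile η)) := by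
    rw [← add_zero (hat f 0 * _)]
    refine ((tendsto_integral_scaled_comovingHat hμ hf).add hhigh).congr' ?_
    filter_upwards [eventually_gt_atTop 0] with t ht
    have hi : Integrable (comovingHat μ f t) :=
      ((integrable_zetaRHat_travelling hμ hf hf1 ht).norm.const_mul 2).mono'
        (measurable_comovingHat μ hf t).aestronglyMeasurable
        (Eventually.of_forall fun ξ => (norm_comovingHat μ f t ξ).le)
    rw [← hlow t ht, ← mul_add, integral_add_compl hS hi]
  have hfin := hsum.norm.mul_const (1 / 2 / μ ^ (2 / 3 : ℝ))
  have he : ‖∫ η, airyProfile η‖ / 2 / μ ^ (2 / 3 : ℝ) * ‖hat f 0‖ =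
      ‖hat f 0 * ∫ η, airyProfile η‖ * (1 / 2 / μ ^ (2 / 3 : ℝ)) := by
    rw [norm_mul]
    ring
  rw [he]
  refine hfin.congr' ?_
  filter_upwards [eventually_gt_atTop 0] with t ht
  rw [zetaR_travelling_self, norm_mul, norm_mul, Complex.norm_real,
    Real.norm_of_nonneg (by positivity), norm_neg, norm_div, Complex.norm_I, Complex.norm_ofNat]
  field_simp

theorem continuous_zetaR_travelling {μ : ℝ} (hμ : 0 < μ) {f : ℝ → ℂ} (hf : Integrable f)
    (hf1 : eH1Norm f ≠ ⊤) {t : ℝ} (ht : 0 < t) : Continuous (zetaR μ (travelling f) t) :=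
  continuous_invHat (integrable_zetaRHat_travelling hμ hf hf1 ht)

/-! ### The lower bound, the growth rate and the conclusion. -/

theorem le_liminf_eLpNorm_zetaR_travelling {μ : ℝ} (hμ : 0 < μ) {f : ℝ → ℂ} (hf : Integrable f)
    (hf1 : eH1Norm f ≠ ⊤) :
    ENNReal.ofReal (‖∫ η, airyProfile η‖ / 2 / μ ^ (2 / 3 : ℝ) * ‖hat f 0‖) ≤
      liminf (fun t : ℝ =>
        eLpNorm (fun X : ℝ => (1 / t ^ (1 / 3 : ℝ)) • zetaR μ (travelling f) t X) ∞ volume)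
        atTop := by
  rw [← (ENNReal.tendsto_ofReal (tendsto_norm_zetaR_travelling_self hμ hf hf1)).liminf_eq]
  refine liminf_le_liminf ?_
  filter_upwards [eventually_gt_atTop 0] with t ht
  have h := enorm_le_eLpNorm_top
    ((continuous_zetaR_travelling hμ hf hf1 ht).const_smul (1 / t ^ (1 / 3 : ℝ))) t
  rwa [← ofReal_norm, Pi.smul_apply, norm_smul, Real.norm_of_nonneg (by positivity)] at h

theorem isTheta_eLpNorm_zetaR_travelling {μ : ℝ} (hμ : 0 < μ) {f : ℝ → ℂ} (hf : Integrable f)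
    (hf1 : eH1Norm f ≠ ⊤) (hf0 : hat f 0 ≠ 0) :
    (fun t : ℝ => (eLpNorm (zetaR μ (travelling f) t) ∞ volume).toReal)
      =Θ[atTop] fun t : ℝ => t ^ (1 / 3 : ℝ) := by
  have hM : eLpNorm f 1 volume ≠ ⊤ := (memLp_one_iff_integrable.mpr hf).2.ne
  have hbt : ∀ t : ℝ, ENNReal.ofReal (32 * μ ^ (1 / 3 : ℝ) * (t ^ (1 / 3 : ℝ) / μ)) *
      eLpNorm f 1 volume + ENNReal.ofReal (100 * μ ^ (1 / 4 : ℝ)) * eH1Norm f ≠ ⊤ := fun t =>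
    ENNReal.add_ne_top.mpr ⟨ENNReal.mul_ne_top ENNReal.ofReal_ne_top hM,
      ENNReal.mul_ne_top ENNReal.ofReal_ne_top hf1⟩
  constructor
  · refine Asymptotics.IsBigO.of_bound (32 * μ ^ (1 / 3 : ℝ) / μ * (eLpNorm f 1 volume).toReal +
      100 * μ ^ (1 / 4 : ℝ) * (eH1Norm f).toReal) ?_
    filter_upwards [eventually_ge_atTop 1] with t ht
    have ht0 : 0 < t := one_pos.trans_le ht
    have h := ENNReal.toReal_mono (hbt t) (eLpNorm_zetaR_travelling_le hμ hf ht0.le)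
    rw [ENNReal.toReal_add (ENNReal.mul_ne_top ENNReal.ofReal_ne_top hM)
      (ENNReal.mul_ne_top ENNReal.ofReal_ne_top hf1), ENNReal.toReal_mul, ENNReal.toReal_mul,
      ENNReal.toReal_ofReal (by positivity), ENNReal.toReal_ofReal (by positivity)] at h
    rw [Real.norm_of_nonneg ENNReal.toReal_nonneg, Real.norm_of_nonneg (by positivity)]
    have h1 : 1 ≤ t ^ (1 / 3 : ℝ) := Real.one_le_rpow ht (by norm_num)
    refine h.trans ?_
    rw [add_mul]
    -- For `t ≥ 1` the time-independent `H¹` term is absorbed into `t^(1/3)`.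
    refine add_le_add (le_of_eq (by ring)) (le_mul_of_one_le_right ?_ h1)
    have := ENNReal.toReal_nonneg (a := eH1Norm f)
    positivity
  · set l := ‖∫ η, airyProfile η‖ / 2 / μ ^ (2 / 3 : ℝ) * ‖hat f 0‖ with hl
    have hl0 : 0 < l := by
      have h1 := norm_pos_iff.mpr integral_airyProfile_ne_zero
      have h2 := norm_pos_iff.mpr hf0
      positivity
    refine Asymptotics.IsBigO.of_bound (2 / l) ?_
    filter_upwards [eventually_gt_atTop 0, (tendsto_norm_zetaR_travelling_self hμ hf hf1).eventually
      (eventually_gt_nhds (half_lt_self hl0))] with t ht hlt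
    have h3 : 0 < t ^ (1 / 3 : ℝ) := by positivity
    rw [Real.norm_of_nonneg ENNReal.toReal_nonneg, Real.norm_of_nonneg h3.le]
    have hfin : eLpNorm (zetaR μ (travelling f) t) ∞ volume ≠ ⊤ :=
      ne_top_of_le_ne_top (hbt t) (eLpNorm_zetaR_travelling_le hμ hf ht.le)
    have h := ENNReal.toReal_mono hfin
      (enorm_le_eLpNorm_top (continuous_zetaR_travelling hμ hf hf1 ht) t)
    rw [toReal_enorm] at h
    rw [one_div_mul_eq_div, lt_div_iff₀ h3] at hlt
    rw [div_mul_eq_mul_div, le_div_iff₀ hl0]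
    linarith

end WaterWaves

open WaterWaves
theorem mainTheorem9 :
    ∃ c : ℝ, 0 < c ∧ ∀ μmax : ℝ, 0 < μmax → ∃ C : ℝ, 0 < C ∧
      ∀ μ : ℝ, 0 < μ → μ ≤ μmax →
      ∀ P₀ : ℝ → ℂ, Integrable P₀ volume → MemH1 P₀ → hat P₀ 0 ≠ 0 →
        -- the amplitude is given by an absolutely convergent integral of the explicit transform
        (∀ t : ℝ, 0 ≤ t →
          (∀ ξ : ℝ, zetaRHat μ (travelling P₀) t ξ =
            -(Complex.I / 2) * ((ξ * omega (√μ * ξ) : ℝ) : ℂ) * hat P₀ ξ *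
              Complex.exp (-(Complex.I * t * ξ)) *
              ∫ s in (-t)..(0 : ℝ), Complex.exp (Complex.I * (s * ξ * (omega (√μ * ξ) - 1) : ℝ))) ∧
          Integrable (zetaRHat μ (travelling P₀) t) volume) ∧
        -- the upper bound
        (∀ t : ℝ, 0 ≤ t →
          eLpNorm (zetaR μ (travelling P₀) t) ∞ volume ≤
            ENNReal.ofReal C *
              (ENNReal.ofReal (t ^ (1 / 3 : ℝ) / μ) * eLpNorm P₀ 1 volume +
                ENNReal.ofReal (μ ^ (1 / 4 : ℝ)) * eH1Norm P₀)) ∧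
        -- the lower bound and the growth rate
        (MemH1 (fun X : ℝ => (X : ℂ) * P₀ X) →
          ENNReal.ofReal (c / μ ^ (2 / 3 : ℝ) * ‖hat P₀ 0‖) ≤
            liminf (fun t : ℝ =>
              eLpNorm (fun X : ℝ => (1 / t ^ (1 / 3 : ℝ)) • zetaR μ (travelling P₀) t X) ∞ volume)
              atTop ∧
          (fun t : ℝ => (eLpNorm (zetaR μ (travelling P₀) t) ∞ volume).toReal)
            =Θ[atTop] fun t : ℝ => t ^ (1 / 3 : ℝ)) := by
  refine ⟨‖∫ η, airyProfile η‖ / 2, half_pos (norm_pos_iff.mpr integral_airyProfile_ne_zero),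
    fun μmax hmax => ⟨32 * μmax ^ (1 / 3 : ℝ) + 100, by positivity, fun μ hμ hle P₀ hP hH h0 => ?_⟩⟩
  have hH' := eH1Norm_ne_top hH
  refine ⟨fun t ht => ⟨zetaRHat_travelling μ P₀ t, ?_⟩, fun t ht => ?_, fun _ =>
    ⟨le_liminf_eLpNorm_zetaR_travelling hμ hP hH', isTheta_eLpNorm_zetaR_travelling hμ hP hH' h0⟩⟩
  · rcases ht.eq_or_lt with rfl | ht
    · rw [zetaRHat_zero]
      exact integrable_zero _ _ _
    · exact integrable_zetaRHat_travelling hμ hP hH' ht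
  · refine (eLpNorm_zetaR_travelling_le hμ hP ht).trans ?_
    -- The natural rate is `t^(1/3)/μ^(2/3) = μ^(1/3) · t^(1/3)/μ`; bounding `μ^(1/3)` is what makes
    -- `C` depend on `μmax`.
    have hμm : μ ^ (1 / 3 : ℝ) ≤ μmax ^ (1 / 3 : ℝ) :=
      Real.rpow_le_rpow hμ.le hle (by norm_num)
    have hpos : 0 ≤ μmax ^ (1 / 3 : ℝ) := by positivity
    rw [mul_add, ← mul_assoc, ← mul_assoc, ← ENNReal.ofReal_mul (by positivity),
      ← ENNReal.ofReal_mul (by positivity)]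
    gcongr
    · linarith
    · linarith
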